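/- Let $\mathcal H$ be a real or complex Hilbert space. A linear operator $T$ in $\mathcal H$, defined on a linear subspace $\operatorname{dom}T$ (not assumed dense or closed), is called \emph{positive} if $\langle Tf,g\rangle=\langle f,Tg\rangle$ and $\langle Tf,f\rangle\ge 0$ for all $f,g\in\operatorname{dom}T$. For a positive self-adjoint $S$, $S^{1/2}$ denotes its unique positive self-adjoint square root. For positive self-adjoint $S_1,S_2$, the form order $S_1\preceq S_2$ means $(I+S_2)^{-1}\le (I+S_1)^{-1}$. Let $T$ be a positive operator in $\mathcal H$ and put $$\mathcal D_*(T)=\{g\in\mathcal H:\ \sup\{|\langle Th,g\rangle|^2:\ h\in\operatorname{dom}T,\ \langle Th,h\rangle\le 1\}<\infty\}.$$ Assume that $T$ satisfies any one of the following conditions (which are equivalent for positive $T$): 1. $T$ has a positive self-adjoint extension; 2. $\mathcal D_*(T)$ is dense in $\mathcal H$; 3. $\mathcal D_*(T)^\perp\subseteq\operatorname{ran}(I+T)$; 4. $\mathcal D_*(T)^\perp\cap\overline{\operatorname{ran}T}=\{0\}$; 5. $T$ is positively closable: if $h_n\in\operatorname{dom}T$, $\langle Th_n,h_n\rangle\to0$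 and $Th_n\to f$, then $f=0$; 6. there are a Hilbert space $\mathcal E$ and a densely defined linear operator $V:\mathcal H\to\mathcal E$ with $\operatorname{dom}T\subseteq\operatorname{dom}V$, $V(\operatorname{dom}T)^\perp=\{0\}$ and $\langle Vg,Vh\rangle_{\mathcal E}=\langle g,Th\rangle$ for all $g\in\operatorname{dom}V$, $h\in\operatorname{dom}T$. Let $\mathcal E_T$ be the completion of $\operatorname{ran}T$ with respect to the inner product $\langle Tf,Th\rangle_{\mathcal E_T}=\langle Tf,h\rangle$, let $J_T:\operatorname{ran}T\subseteq\mathcal E_T\to\mathcal H$, $J_T(Th)=Th$, and let $T_N=J_T^{**}J_T^{*}$ be the Krein-von Neumann extension of $T$. (A) For every positive self-adjoint operator $S$ in $\mathcal H$ the following are equivalent: (i) $S$ is an extension of $T$; (ii) (a) $T_N\preceq S$, (b) $\operatorname{dom}T\subseteq\operatorname{dom}S^{1/2}$, and (c) $\|S^{1/2}f\|^2\le\langle Tf,f\rangle$ for every $f\in\operatorname{dom}T$. (B) Consequently, if $R$ and $S$ are positive self-adjoint operators in $\mathcal H$ such that $T\subset R$ and $T_N\preceq S\preceq R$, then $T\subset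 S$. -/

import Mathlib

open Filter Topology

noncomputable section

namespace KreinExtension

universe u

section General

variable {𝕜 : Type*} [RCLike 𝕜]
variable {H : Type u} [NormedAddCommGroup H] [InnerProductSpace 𝕜 H]

/-- A (not necessarily densely defined) linear operator `T` in `H` is positive if it is symmetric,
`⟪T f, g⟫ = ⟪f, T g⟫` on `dom T`, and its quadratic form is nonnegative. By symmetry the number
`⟪T f, f⟫` is real, so the form is read off through the real part. -/
structure IsPositive (T : H →ₗ.[𝕜] H) : Prop where
  symmetric : ∀ f g : T.domain, inner 𝕜 (T f) (g : H) = inner 𝕜 (f : H) (T g)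
  nonneg : ∀ f : T.domain, 0 ≤ RCLike.re (inner 𝕜 (T f) (f : H))

/-- The product `A B` of two partially defined operators, on its natural domain
`{x ∈ dom B | B x ∈ dom A}`. -/
def opComp {E F G : Type*} [AddCommGroup E] [Module 𝕜 E] [AddCommGroup F] [Module 𝕜 F]
    [AddCommGroup G] [Module 𝕜 G] (A : F →ₗ.[𝕜] G) (B : E →ₗ.[𝕜] F) : E →ₗ.[𝕜] G where
  domain :=
    { carrier := {x | ∃ hx : x ∈ B.domain, B ⟨x, hx⟩ ∈ A.domain}
      zero_mem' := ⟨B.domain.zero_mem, by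
        have h : B ⟨0, B.domain.zero_mem⟩ = 0 := B.map_zero
        rw [h]; exact A.domain.zero_mem⟩
      add_mem' := by
        rintro x y ⟨hx, hx'⟩ ⟨hy, hy'⟩
        refine ⟨B.domain.add_mem hx hy, ?_⟩
        have h : B ⟨x + y, B.domain.add_mem hx hy⟩ = B ⟨x, hx⟩ + B ⟨y, hy⟩ :=
          B.map_add ⟨x, hx⟩ ⟨y, hy⟩
        rw [h]; exact A.domain.add_mem hx' hy'
      smul_mem' := by
        rintro c x ⟨hx, hx'⟩
        refine ⟨B.domain.smul_mem c hx, ?_⟩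
        have h : B ⟨c • x, B.domain.smul_mem c hx⟩ = c • B ⟨x, hx⟩ := B.map_smul c ⟨x, hx⟩
        rw [h]; exact A.domain.smul_mem c hx' }
  toFun :=
    { toFun := fun x => A ⟨B ⟨x.1, x.2.choose⟩, x.2.choose_spec⟩
      map_add' := by
        intro x y
        rw [← A.map_add]
        congr 1
        exact Subtype.ext (B.map_add ⟨x.1, x.2.choose⟩ ⟨y.1, y.2.choose⟩)
      map_smul' := by
        intro c x
        rw [RingHom.id_apply, ← A.map_smul]
        congr 1
        exact Subtype.ext (B.map_smul c ⟨x.1, x.2.choose⟩) }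

/-- `I + T`, with domain `dom T`. -/
def idAdd (T : H →ₗ.[𝕜] H) : H →ₗ.[𝕜] H :=
  (LinearMap.id : H →ₗ[𝕜] H).toPMap ⊤ + T

/-- The form order `S₁ ⪯ S₂`, that is `(I + S₂)⁻¹ ≤ (I + S₁)⁻¹`, where the two inverses are
everywhere defined and are compared through their quadratic forms. -/
def FormLE (S₁ S₂ : H →ₗ.[𝕜] H) : Prop :=
  ∀ x : H, ∃ (h₁ : x ∈ (idAdd S₁).inverse.domain) (h₂ : x ∈ (idAdd S₂).inverse.domain),
    RCLike.re (inner 𝕜 ((idAdd S₂).inverse ⟨x, h₂⟩) x) ≤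
      RCLike.re (inner 𝕜 ((idAdd S₁).inverse ⟨x, h₁⟩) x)

/-- The linear subspace `𝓓_*(T)` of all `g ∈ H` with
`sup {|⟪T h, g⟫|² | h ∈ dom T, ⟪T h, h⟫ ≤ 1} < ∞`. -/
def DStar (T : H →ₗ.[𝕜] H) : Submodule 𝕜 H where
  carrier := {g | BddAbove {r : ℝ | ∃ h : T.domain,
    RCLike.re (inner 𝕜 (T h) (h : H)) ≤ 1 ∧ r = ‖inner 𝕜 (T h) g‖ ^ 2}}
  zero_mem' := ⟨0, by rintro r ⟨h, -, rfl⟩; simp⟩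
  add_mem' := by
    rintro a b ⟨m, hm⟩ ⟨n, hn⟩
    refine ⟨2 * m + 2 * n, ?_⟩
    rintro r ⟨h, hh, rfl⟩
    have h1 := hm ⟨h, hh, rfl⟩
    have h2 := hn ⟨h, hh, rfl⟩
    have h3 : ‖inner 𝕜 (T h) (a + b)‖ ≤ ‖inner 𝕜 (T h) a‖ + ‖inner 𝕜 (T h) b‖ := by
      rw [inner_add_right]; exact norm_add_le _ _
    have h4 := norm_nonneg (inner 𝕜 (T h) (a + b))
    nlinarith [sq_nonneg (‖inner 𝕜 (T h) a‖ - ‖inner 𝕜 (T h) b‖)]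
  smul_mem' := by
    rintro c a ⟨m, hm⟩
    refine ⟨‖c‖ ^ 2 * m, ?_⟩
    rintro r ⟨h, hh, rfl⟩
    have h1 := hm ⟨h, hh, rfl⟩
    rw [inner_smul_right, norm_mul, mul_pow]
    exact mul_le_mul_of_nonneg_left h1 (sq_nonneg _)

variable [CompleteSpace H]

/-- `R` is a positive self-adjoint square root of `S`. -/
def IsPositiveSqrt (R S : H →ₗ.[𝕜] H) : Prop :=
  IsPositive R ∧ IsSelfAdjoint R ∧ opComp R R = S

open scoped Classical in
/-- The square root `S^{1/2}` of a positive self-adjoint operator `S`, i.e. the unique positive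
self-adjoint `R` with `R R = S`; the value is irrelevant for operators `S` without a
positive self-adjoint square root. -/
def sqrtOp (S : H →ₗ.[𝕜] H) : H →ₗ.[𝕜] H :=
  if h : ∃ R : H →ₗ.[𝕜] H, IsPositiveSqrt R S then h.choose else ⊥

/-- `T` has a positive self-adjoint extension. -/
def HasPositiveExtension (T : H →ₗ.[𝕜] H) : Prop :=
  ∃ S : H →ₗ.[𝕜] H, IsPositive S ∧ IsSelfAdjoint S ∧ T ≤ S

/-- Positive closability: `⟪T hₙ, hₙ⟫ → 0` and `T hₙ → f` imply `f = 0`. -/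
def IsPositivelyClosable (T : H →ₗ.[𝕜] H) : Prop :=
  ∀ (h : ℕ → T.domain) (f : H),
    Tendsto (fun n => RCLike.re (inner 𝕜 (T (h n)) (h n : H))) atTop (𝓝 0) →
    Tendsto (fun n => T (h n)) atTop (𝓝 f) → f = 0

/-- There are a Hilbert space `E` and a densely defined operator `V : H → E` with
`dom T ⊆ dom V`, `V(dom T)^⊥ = {0}` and `⟪V g, V h⟫ = ⟪g, T h⟫` for `g ∈ dom V`, `h ∈ dom T`. -/
def HasFactorization (T : H →ₗ.[𝕜] H) : Prop :=
  ∃ (E : Type u) (_ : NormedAddCommGroup E) (_ : InnerProductSpace 𝕜 E) (_ : CompleteSpace E)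
    (V : H →ₗ.[𝕜] E) (hTV : T.domain ≤ V.domain),
    Dense (V.domain : Set H) ∧
    (LinearMap.range (V.toFun.comp (Submodule.inclusion hTV)))ᗮ = ⊥ ∧
    ∀ (g : V.domain) (h : T.domain),
      inner 𝕜 (V g) (V ⟨h, hTV h.2⟩) = inner 𝕜 (g : H) (T h)

/-- `T` satisfies one of the (for positive `T` equivalent) criteria for the existence of a positive
self-adjoint extension:
existence of such an extension; density of `𝓓_*(T)`; `𝓓_*(T)^⊥ ⊆ ran (I + T)`;
`𝓓_*(T)^⊥ ∩ closure (ran T) = {0}`; positive closability; existence of a factorization.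
Taking any single one of them as a hypothesis is covered, their equivalence is not presupposed. -/
inductive IsExtendable (T : H →ₗ.[𝕜] H) : Prop
  | extension (h : HasPositiveExtension T)
  | dense (h : Dense (DStar T : Set H))
  | orthogonal_le_range (h : (DStar T)ᗮ ≤ LinearMap.range (idAdd T).toFun)
  | orthogonal_inf_closure (h : (DStar T)ᗮ ⊓ (LinearMap.range T.toFun).topologicalClosure = ⊥)
  | positivelyClosable (h : IsPositivelyClosable T)
  | factorization (h : HasFactorization T)

end General

section EnergySpace

variable {𝕜 : Type*} [RCLike 𝕜]
variable {H : Type u} [NormedAddCommGroup H] [InnerProductSpace 𝕜 H]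
variable {T : H →ₗ.[𝕜] H}

/-- The space `ran T` of a positive operator `T`, as a type of its own, to be equipped with the
energy inner product instead of that of `H`. -/
@[nolint unusedArguments]
def EnergyPre (_hT : IsPositive T) : Type u := LinearMap.range T.toFun

instance (hT : IsPositive T) : AddCommGroup (EnergyPre hT) :=
  inferInstanceAs (AddCommGroup (LinearMap.range T.toFun))

instance (hT : IsPositive T) : Module 𝕜 (EnergyPre hT) :=
  inferInstanceAs (Module 𝕜 (LinearMap.range T.toFun))

/-- The set-theoretic inclusion `ran T → H`, `T h ↦ T h`. -/
def EnergyPre.val (hT : IsPositive T) : EnergyPre hT →ₗ[𝕜] H :=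
  (LinearMap.range T.toFun).subtype

/-- The element `T h` of `ran T`. -/
def EnergyPre.mk (hT : IsPositive T) (h : T.domain) : EnergyPre hT :=
  LinearMap.rangeRestrict T.toFun h

theorem EnergyPre.val_mk (hT : IsPositive T) (h : T.domain) :
    EnergyPre.val hT (EnergyPre.mk hT h) = T h := rfl

theorem EnergyPre.exists_rep (hT : IsPositive T) (x : EnergyPre hT) :
    ∃ h : T.domain, EnergyPre.mk hT h = x := by
  obtain ⟨x, h, rfl⟩ := x
  exact ⟨h, rfl⟩

/-- The energy inner product `⟪T f, T h⟫_E = ⟪T f, h⟫`. -/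
def EnergyPre.innerE (hT : IsPositive T) (x y : EnergyPre hT) : 𝕜 :=
  inner 𝕜 (EnergyPre.val hT x) ((EnergyPre.exists_rep hT y).choose : H)

theorem EnergyPre.innerE_mk (hT : IsPositive T) (f h : T.domain) :
    EnergyPre.innerE hT (EnergyPre.mk hT f) (EnergyPre.mk hT h) = inner 𝕜 (T f) (h : H) := by
  have key := (EnergyPre.exists_rep hT (EnergyPre.mk hT h)).choose_spec
  have key' := congrArg (EnergyPre.val hT) key
  rw [EnergyPre.val_mk, EnergyPre.val_mk] at key'
  rw [EnergyPre.innerE, EnergyPre.val_mk, hT.symmetric, key', ← hT.symmetric]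

/-- The energy (semi-)inner product as a pre-inner product on `ran T`. -/
abbrev EnergyPre.core (hT : IsPositive T) : PreInnerProductSpace.Core 𝕜 (EnergyPre hT) where
  inner := EnergyPre.innerE hT
  conj_inner_symm x y := by
    obtain ⟨f, rfl⟩ := EnergyPre.exists_rep hT x
    obtain ⟨h, rfl⟩ := EnergyPre.exists_rep hT y
    rw [EnergyPre.innerE_mk, EnergyPre.innerE_mk, inner_conj_symm, hT.symmetric]
  re_inner_nonneg x := by
    obtain ⟨f, rfl⟩ := EnergyPre.exists_rep hT x
    rw [EnergyPre.innerE_mk]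
    exact hT.nonneg f
  add_left x y z := by
    simp only [EnergyPre.innerE, map_add, inner_add_left]
  smul_left x y c := by
    simp only [EnergyPre.innerE, map_smul, inner_smul_left]

instance (hT : IsPositive T) : SeminormedAddCommGroup (EnergyPre hT) :=
  InnerProductSpace.Core.toSeminormedAddCommGroup (c := EnergyPre.core hT)

instance (hT : IsPositive T) : InnerProductSpace 𝕜 (EnergyPre hT) :=
  InnerProductSpace.ofCore (EnergyPre.core hT)

theorem EnergyPre.inner_mk (hT : IsPositive T) (f h : T.domain) :
    inner 𝕜 (EnergyPre.mk hT f) (EnergyPre.mk hT h) = inner 𝕜 (T f) (h : H) :=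
  EnergyPre.innerE_mk hT f h

/-- The energy space of `T`: the Hilbert space completion of `ran T` with respect to the energy
inner product (which is definite whenever `T` has a positive self-adjoint extension). -/
abbrev EnergySpace (hT : IsPositive T) : Type u := UniformSpace.Completion (EnergyPre hT)

/-- The natural embedding `J_T : ran T ⊆ E_T → H`, `T h ↦ T h`, given by its graph. -/
def energyEmbedding (hT : IsPositive T) : EnergySpace hT →ₗ.[𝕜] H :=
  (LinearMap.range ((UniformSpace.Completion.toComplₗᵢ (𝕜 := 𝕜)
    (E := EnergyPre hT)).toLinearMap.prod (EnergyPre.val hT))).toLinearPMap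

/-- The Krein-von Neumann extension `T_N = J_T^{**} J_T^*`. -/
def kreinVonNeumann [CompleteSpace H] (hT : IsPositive T) : H →ₗ.[𝕜] H :=
  opComp (energyEmbedding hT).adjoint.adjoint (energyEmbedding hT).adjoint

end EnergySpace

end KreinExtension

end

/-! Write `J` for the energy embedding and `R` for the square root of `S`. Since `T_N = J** J*`, the
form of `T_N` is `‖J* g‖²`, and `J* f` is just `T f` viewed in the energy space when `f ∈ dom T`, so
`‖J* f‖² = ⟪T f, f⟫` there. The form order means `dom R ⊆ dom J*` and `‖J* g‖ ≤ ‖R g‖` on `dom R`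
(`formLE_adjoint_self_iff`).

If `S` extends `T`, then `⟪g, T k⟫ = ⟪R g, R k⟫`, and Cauchy–Schwarz bounds this by `‖R g‖` times
the energy norm of `T k`, which is the required bound on `J* g`. Conversely, the conditions of (ii)
make the nonnegative form `‖R g‖² - ‖J* g‖²` vanish at each `f ∈ dom T`. Such an `f` lies in its
radical (`inner_apply_eq_of_norm_le`), so `⟪R f, R g⟫ = ⟪J* f, J* g⟫ = ⟪T f, g⟫` on `dom R`, and
self-adjointness of `R` gives `R R f = T f`. For (B), `S ⪯ R` transfers the bound on `dom T` from
`R` to `S`.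

The extendability criteria enter only through the density of `𝓓_*(T)`, which each implies and which
makes `J` single-valued and `J*` densely defined. Square roots are built from the bounded resolvent.
-/

namespace KreinExtension

universe u

/-! ### Square roots of bounded operators by iteration -/

section BoundedSqrt

/-- The map `z ↦ (b + z²) / 2` with `‖b‖ ≤ 1` has a fixed point lying in every closed set that
contains `0` and is stable under the map. -/
theorem exists_eq_half_add_sq (𝕜 : Type*) [RCLike 𝕜] {R : Type*} [NormedRing R] [NormedAlgebra 𝕜 R]
    [CompleteSpace R] {b : R} (hb : ‖b‖ ≤ 1) :
    ∃ y : R, y = (2⁻¹ : 𝕜) • (b + y * y) ∧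
      ∀ s : Set R, IsClosed s → (0 : R) ∈ s → (∀ z ∈ s, (2⁻¹ : 𝕜) • (b + z * z) ∈ s) → y ∈ s := by
  set F : R → R := fun z => (2⁻¹ : 𝕜) • (b + z * z) with hF
  -- The scalar iteration with `b = 1` is a majorant: it stays in `[0, 1]`, dominates the norms of
  -- the iterates, and its increments dominate theirs, so the telescoping sum gives convergence.
  set f : ℝ → ℝ := fun t => (1 + t * t) / 2 with hf
  set x : ℕ → R := fun n => F^[n] 0 with hx
  set t : ℕ → ℝ := fun n => f^[n] 0 with ht
  have xs : ∀ n, x (n + 1) = F (x n) := fun n => Function.iterate_succ_apply' F n 0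
  have ts : ∀ n, t (n + 1) = f (t n) := fun n => Function.iterate_succ_apply' f n 0
  have n2 : ‖(2⁻¹ : 𝕜)‖ = 1 / 2 := by simp
  have t01 : ∀ n, 0 ≤ t n ∧ t n ≤ 1 := by
    intro n
    induction n with
    | zero => simp [ht]
    | succ n ih => rw [ts]; constructor <;> simp only [hf] <;> nlinarith
  have xt : ∀ n, ‖x n‖ ≤ t n := by
    intro n
    induction n with
    | zero => simp [ht, hx]
    | succ n ih =>
      rw [ts, xs, hF, hf]
      simp only
      rw [norm_smul, n2]
      have h1 := norm_add_le b (x n * x n)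
      have h2 := norm_mul_le (x n) (x n)
      nlinarith [norm_nonneg (x n)]
  have step : ∀ n, ‖x (n + 1) - x n‖ ≤ t (n + 1) - t n := by
    intro n
    induction n with
    | zero =>
      have := xt 1
      simpa [ht, hx] using this
    | succ n ih =>
      have e : x (n + 1 + 1) - x (n + 1)
          = (2⁻¹ : 𝕜) • (x (n + 1) * (x (n + 1) - x n) + (x (n + 1) - x n) * x n) := by
        have : F (x (n + 1)) - F (x n)
            = (2⁻¹ : 𝕜) • (x (n + 1) * (x (n + 1) - x n) + (x (n + 1) - x n) * x n) := by
          simp only [hF]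
          rw [← smul_sub]
          congr 1
          noncomm_ring
        rwa [← xs, ← xs] at this
      have e' : t (n + 1 + 1) - t (n + 1) = 1 / 2 * (t (n + 1) * (t (n + 1) - t n)
          + (t (n + 1) - t n) * t n) := by
        have : f (t (n + 1)) - f (t n) = 1 / 2 * (t (n + 1) * (t (n + 1) - t n)
          + (t (n + 1) - t n) * t n) := by simp only [hf]; ring
        rwa [← ts, ← ts] at this
      rw [e, e', norm_smul, n2]
      gcongr
      refine (norm_add_le _ _).trans (add_le_add ?_ ?_)
      · exact (norm_mul_le _ _).trans (mul_le_mul (xt _) ih (norm_nonneg _) (t01 _).1)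
      · exact (norm_mul_le _ _).trans (mul_le_mul ih (xt _) (norm_nonneg _)
          ((norm_nonneg _).trans ih))
  have hsum : Summable fun n => t (n + 1) - t n := by
    refine summable_of_sum_range_le (c := 1) (fun n => (norm_nonneg _).trans (step n)) fun n => ?_
    rw [Finset.sum_range_sub]
    have := (t01 n).2
    have := (t01 0).1
    linarith
  have hc : CauchySeq x := by
    refine cauchySeq_of_dist_le_of_summable _ (fun n => ?_) hsum
    rw [dist_comm, dist_eq_norm]
    exact step n
  obtain ⟨y, hy⟩ := cauchySeq_tendsto_of_complete hc
  have hFc : Continuous F := by simp only [hF]; fun_prop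
  refine ⟨y, ?_, fun s hs h0 hst => hs.mem_of_tendsto hy (Eventually.of_forall fun n => ?_)⟩
  · have h1 : Tendsto (fun n => x (n + 1)) atTop (𝓝 y) := hy.comp (tendsto_add_atTop_nat 1)
    have h2 : Tendsto (fun n => x (n + 1)) atTop (𝓝 (F y)) := by
      simp only [xs]
      exact (hFc.tendsto y).comp hy
    exact tendsto_nhds_unique h1 h2
  · induction n with
    | zero => exact h0
    | succ n ih => rw [xs]; exact hst _ ih

variable {𝕜 : Type*} [RCLike 𝕜]
variable {H : Type*} [NormedAddCommGroup H] [InnerProductSpace 𝕜 H] [CompleteSpace H]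

/-- A symmetric bounded operator `A` with `‖1 - A‖ ≤ 1` has a positive square root which commutes
with everything that commutes with `A`. -/
theorem exists_bounded_sqrt {A : H →L[𝕜] H} (hA : IsSelfAdjoint A) (hA1 : ‖1 - A‖ ≤ 1) :
    ∃ P : H →L[𝕜] H, P.IsPositive ∧ P * P = A ∧ ‖1 - P‖ ≤ 1 ∧
      ∀ C : H →L[𝕜] H, Commute C A → Commute C P := by
  -- The equation `2 y = 1 - A + y²` says `(1 - y)² = A`. Norm bound, self-adjointness and
  -- commutation are closed conditions preserved by the iteration, hence hold for `y`.
  obtain ⟨y, hy, hs⟩ := exists_eq_half_add_sq 𝕜 hA1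
  have hnorm : ‖y‖ ≤ 1 := by
    have := hs (Metric.closedBall 0 1) Metric.isClosed_closedBall (by simp) fun z hz => by
      simp only [mem_closedBall_zero_iff] at hz ⊢
      rw [norm_smul]
      have h1 := norm_add_le (1 - A) (z * z)
      have h2 := norm_mul_le z z
      have n2 : ‖(2⁻¹ : 𝕜)‖ = 1 / 2 := by simp
      rw [n2]
      nlinarith [norm_nonneg z]
    simpa using this
  have hsa : IsSelfAdjoint y := by
    refine hs {z | IsSelfAdjoint z} ?_ (.zero _) fun z hz => ?_
    · exact isClosed_eq continuous_star continuous_id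
    · have h2 : IsSelfAdjoint (2⁻¹ : 𝕜) := by
        rw [isSelfAdjoint_iff]; simp
      refine h2.smul (((IsSelfAdjoint.one _).sub hA).add ?_)
      have h3 : IsSelfAdjoint z := hz
      exact (h3.commute_iff h3).1 (Commute.refl z)
  refine ⟨1 - y, ?_, ?_, by simpa using hnorm, fun C hC => ?_⟩
  · rw [ContinuousLinearMap.isPositive_def']
    refine ⟨(IsSelfAdjoint.one _).sub hsa, fun x => ?_⟩
    rw [ContinuousLinearMap.reApplyInnerSelf_apply]
    have h1 : RCLike.re (inner 𝕜 (y x) x) ≤ ‖x‖ * ‖x‖ := by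
      refine (RCLike.re_le_norm _).trans ((norm_inner_le_norm _ _).trans ?_)
      gcongr
      exact y.le_of_opNorm_le_of_le hnorm le_rfl |>.trans (by simp)
    simp only [sub_apply, one_apply_eq_self, inner_sub_left,
      map_sub, inner_self_eq_norm_mul_norm]
    linarith
  · have h2 : y + y = 1 - A + y * y := by
      conv_lhs => rw [hy]
      rw [← add_smul]
      have : (2⁻¹ : 𝕜) + 2⁻¹ = 1 := by norm_num
      rw [this, one_smul]
    have : (1 - y) * (1 - y) = 1 - (y + y) + y * y := by noncomm_ring
    rw [this, h2]
    abel
  · refine (Commute.one_right C).sub_right ?_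
    refine hs {z | Commute C z} ?_ (Commute.zero_right C) fun z hz => ?_
    · exact isClosed_eq (continuous_const.mul continuous_id) (continuous_id.mul continuous_const)
    · exact (((Commute.one_right C).sub_right hC).add_right
        (Commute.mul_right hz hz)).smul_right _

end BoundedSqrt

/-! ### Douglas' lemma and graphs as Hilbert spaces -/

section GraphSpace

variable {𝕜 : Type*} [RCLike 𝕜]
variable {H : Type*} [NormedAddCommGroup H] [InnerProductSpace 𝕜 H]
variable {E : Type*} [NormedAddCommGroup E] [InnerProductSpace 𝕜 E]
variable {F : Type*} [NormedAddCommGroup F] [InnerProductSpace 𝕜 F]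

/-- Douglas' lemma: if `‖Q† x‖ ≤ ‖P† x‖` for all `x` then `Q` maps every vector into the range of
`P`, with a preimage of no larger norm. -/
theorem exists_apply_eq_of_norm_adjoint_le [CompleteSpace H] [CompleteSpace E] [CompleteSpace F]
    {P : E →L[𝕜] H} {Q : F →L[𝕜] H} (h : ∀ x, ‖Q.adjoint x‖ ≤ ‖P.adjoint x‖) (g : F) :
    ∃ p : E, P p = Q g ∧ ‖p‖ ≤ ‖g‖ := by
  -- By the norm inequality, `x ↦ ⟪g, Q† x⟫` factors through `P† x` with bound `‖g‖`. Hahn–Banach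
  -- extends it to `E` with the same norm, and the Riesz vector is the preimage.
  let f : H →ₗ[𝕜] 𝕜 := (innerSL 𝕜 g ∘L Q.adjoint).toLinearMap
  have hf : f ∈ LinearMap.range (P.adjoint.toLinearMap.dualMap) := by
    rw [LinearMap.range_dualMap_eq_dualAnnihilator_ker, Submodule.mem_dualAnnihilator]
    intro w hw
    have hw' : P.adjoint w = 0 := hw
    have : Q.adjoint w = 0 := by simpa [hw'] using h w
    simp [f, this]
  obtain ⟨φ, hφ⟩ := hf
  have hφ' : ∀ x, φ (P.adjoint x) = inner 𝕜 g (Q.adjoint x) := fun x => LinearMap.congr_fun hφ x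
  let p := LinearMap.range P.adjoint.toLinearMap
  have hb : ∀ z : p, ‖φ.domRestrict p z‖ ≤ ‖g‖ * ‖z‖ := by
    rintro ⟨_, x, rfl⟩
    change ‖φ (P.adjoint x)‖ ≤ ‖g‖ * ‖P.adjoint x‖
    rw [hφ']
    exact (norm_inner_le_norm _ _).trans (by gcongr; exact h x)
  obtain ⟨ψ, hψ, hψn⟩ := exists_extension_norm_eq p ((φ.domRestrict p).mkContinuous _ hb)
  refine ⟨(InnerProductSpace.toDual 𝕜 E).symm ψ, ?_, ?_⟩
  · refine ext_inner_right 𝕜 fun x => ?_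
    rw [← ContinuousLinearMap.adjoint_inner_right, InnerProductSpace.toDual_symm_apply,
      ← ContinuousLinearMap.adjoint_inner_right, ← hφ']
    exact hψ ⟨P.adjoint x, x, rfl⟩
  · rw [LinearIsometryEquiv.norm_map, hψn]
    exact LinearMap.mkContinuous_norm_le _ (norm_nonneg g) _

/-- The graph of `A` as a subspace of the Hilbert sum of `H` and `E`. -/
def graphSpace (A : H →ₗ.[𝕜] E) : Submodule 𝕜 (WithLp 2 (H × E)) :=
  A.graph.comap (WithLp.linearEquiv 2 𝕜 (H × E)).toLinearMap

/-- The element `(x, A x)` of the graph of `A`. -/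
def graphMk (A : H →ₗ.[𝕜] E) (x : A.domain) : graphSpace A :=
  ⟨WithLp.toLp 2 ((x : H), A x), A.mem_graph x⟩

theorem graphSpace.exists_rep {A : H →ₗ.[𝕜] E} (p : graphSpace A) : ∃ x, graphMk A x = p := by
  obtain ⟨p, hp⟩ := p
  obtain ⟨x, hx⟩ := (A.mem_graph_iff').1 hp
  exact ⟨x, Subtype.ext (congrArg (WithLp.toLp 2) hx)⟩

theorem inner_graphMk (A : H →ₗ.[𝕜] E) (x y : A.domain) :
    inner 𝕜 (graphMk A x) (graphMk A y) = inner 𝕜 (x : H) (y : H) + inner 𝕜 (A x) (A y) := rfl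

theorem norm_graphMk_sq (A : H →ₗ.[𝕜] E) (x : A.domain) :
    ‖graphMk A x‖ ^ 2 = ‖(x : H)‖ ^ 2 + ‖A x‖ ^ 2 :=
  WithLp.prod_norm_sq_eq_of_L2 _

/-- The projection `(x, A x) ↦ x` of the graph of `A` to the first component. -/
def graphFst (A : H →ₗ.[𝕜] E) : graphSpace A →L[𝕜] H :=
  (WithLp.fstL 2 𝕜 H E) ∘L (graphSpace A).subtypeL

@[simp]
theorem graphFst_graphMk (A : H →ₗ.[𝕜] E) (x : A.domain) : graphFst A (graphMk A x) = x := rfl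

theorem completeSpace_graphSpace [CompleteSpace H] [CompleteSpace E] {A : H →ₗ.[𝕜] E}
    (hA : A.IsClosed) : CompleteSpace (graphSpace A) := by
  have : _root_.IsClosed (graphSpace A : Set (WithLp 2 (H × E))) :=
    hA.preimage (WithLp.prod_continuous_ofLp 2 H E)
  exact this.completeSpace_coe

end GraphSpace

/-! ### Resolvents of `A† A` and the form order -/

section Resolvent

variable {𝕜 : Type*} [RCLike 𝕜]
variable {H : Type*} [NormedAddCommGroup H] [InnerProductSpace 𝕜 H]
variable {E : Type*} [NormedAddCommGroup E] [InnerProductSpace 𝕜 E]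
variable {F : Type*} [NormedAddCommGroup F] [InnerProductSpace 𝕜 F]

theorem mem_opComp_domain {A : F →ₗ.[𝕜] E} {B : H →ₗ.[𝕜] F} {x : H} :
    x ∈ (opComp A B).domain ↔ ∃ hx : x ∈ B.domain, B ⟨x, hx⟩ ∈ A.domain := Iff.rfl

theorem opComp_apply {A : F →ₗ.[𝕜] E} {B : H →ₗ.[𝕜] F} {x : H} (hx : x ∈ B.domain)
    (hBx : B ⟨x, hx⟩ ∈ A.domain) (h : x ∈ (opComp A B).domain) :
    opComp A B ⟨x, h⟩ = A ⟨B ⟨x, hx⟩, hBx⟩ := rfl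

theorem mem_idAdd_domain {S : H →ₗ.[𝕜] H} {u : H} : u ∈ (idAdd S).domain ↔ u ∈ S.domain :=
  ⟨fun h => h.2, fun h => ⟨trivial, h⟩⟩

theorem ker_idAdd {S : H →ₗ.[𝕜] H}
    (hS : ∀ u : S.domain, 0 ≤ RCLike.re (inner 𝕜 (S u) (u : H))) :
    LinearMap.ker (idAdd S).toFun = ⊥ := by
  rw [LinearMap.ker_eq_bot']
  rintro ⟨u, hu⟩ h0
  have hu' := mem_idAdd_domain.1 hu
  have h1 : u + S ⟨u, hu'⟩ = 0 := h0
  have h2 : inner 𝕜 (u + S ⟨u, hu'⟩) u = 0 := by rw [h1, inner_zero_left]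
  have h3 := congrArg RCLike.re h2
  rw [inner_add_left, map_add, inner_self_eq_norm_mul_norm, map_zero] at h3
  have h4 : 0 ≤ RCLike.re (inner 𝕜 (S ⟨u, hu'⟩) u) := hS ⟨u, hu'⟩
  have : ‖u‖ = 0 := by nlinarith [norm_nonneg u]
  exact Subtype.ext (norm_eq_zero.1 this)

theorem mem_inverse_idAdd_domain {S : H →ₗ.[𝕜] H} (u : S.domain) :
    (u : H) + S u ∈ (idAdd S).inverse.domain := by
  rw [LinearPMap.inverse_domain]
  exact ⟨⟨u, mem_idAdd_domain.2 u.2⟩, rfl⟩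

theorem inverse_idAdd_apply {S : H →ₗ.[𝕜] H}
    (hS : ∀ u : S.domain, 0 ≤ RCLike.re (inner 𝕜 (S u) (u : H))) {x : H} (u : S.domain)
    (hx : (u : H) + S u = x) (h : x ∈ (idAdd S).inverse.domain) :
    (idAdd S).inverse ⟨x, h⟩ = u :=
  LinearPMap.inverse_apply_eq (ker_idAdd hS) (x := ⟨u, mem_idAdd_domain.2 u.2⟩) hx

variable [CompleteSpace H]

theorem re_inner_adjoint_self_nonneg {A : H →ₗ.[𝕜] E} (hd : Dense (A.domain : Set H))
    (u : (opComp A.adjoint A).domain) :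
    0 ≤ RCLike.re (inner 𝕜 (opComp A.adjoint A u) (u : H)) := by
  obtain ⟨u, h⟩ := u
  obtain ⟨hu, hAu⟩ := mem_opComp_domain.1 h
  rw [opComp_apply hu hAu, LinearPMap.adjoint_isFormalAdjoint hd ⟨_, hAu⟩ ⟨u, hu⟩]
  exact inner_self_nonneg

/-- The resolvent of `A† A` at `-1` in terms of the graph projection of `A`. -/
theorem exists_adjoint_self_resolvent {A : H →ₗ.[𝕜] E} (hd : Dense (A.domain : Set H))
    [CompleteSpace (graphSpace A)] (x : H) :
    ∃ u : (opComp A.adjoint A).domain,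
      (u : H) = graphFst A ((graphFst A).adjoint x) ∧ (u : H) + opComp A.adjoint A u = x := by
  obtain ⟨y, hy⟩ := graphSpace.exists_rep ((graphFst A).adjoint x)
  -- The defining property of the adjoint of the graph projection, `⟪x, z⟫ = ⟪y, z⟫ + ⟪A y, A z⟫`,
  -- is the weak form of `y + A† A y = x`.
  have key : ∀ z : A.domain, inner 𝕜 (x - y) (z : H) = inner 𝕜 (A y) (A z) := fun z => by
    have h1 : inner 𝕜 ((graphFst A).adjoint x) (graphMk A z) = inner 𝕜 x (z : H) := by
      rw [ContinuousLinearMap.adjoint_inner_left, graphFst_graphMk]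
    rw [← hy, inner_graphMk] at h1
    rw [inner_sub_left, ← h1]
    ring
  have hm : A y ∈ A.adjoint.domain := LinearPMap.mem_adjoint_domain_of_exists _ ⟨x - y, key⟩
  refine ⟨⟨y, mem_opComp_domain.2 ⟨y.2, hm⟩⟩, by rw [← hy, graphFst_graphMk], ?_⟩
  rw [opComp_apply y.2 hm, LinearPMap.adjoint_apply_eq hd ⟨A y, hm⟩ key]
  abel

/-- The resolvent is `P P†` for the graph projection `P`; this turns the form order into the norm
inequality of Douglas' lemma. -/
theorem re_inner_inverse_idAdd {A : H →ₗ.[𝕜] E} (hd : Dense (A.domain : Set H))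
    [CompleteSpace (graphSpace A)] (x : H) :
    ∃ h : x ∈ (idAdd (opComp A.adjoint A)).inverse.domain,
      RCLike.re (inner 𝕜 ((idAdd (opComp A.adjoint A)).inverse ⟨x, h⟩) x)
        = ‖(graphFst A).adjoint x‖ ^ 2 := by
  obtain ⟨u, hu, hux⟩ := exists_adjoint_self_resolvent hd x
  have h : x ∈ (idAdd (opComp A.adjoint A)).inverse.domain := by
    have := mem_inverse_idAdd_domain u
    rwa [hux] at this
  refine ⟨h, ?_⟩
  rw [inverse_idAdd_apply (re_inner_adjoint_self_nonneg hd) u hux, hu,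
    ← ContinuousLinearMap.adjoint_inner_right, inner_self_eq_norm_sq]

variable [CompleteSpace E] [CompleteSpace F]

/-- The order of the resolvents of `A† A` and `B† B` is the order of their quadratic forms. -/
theorem formLE_adjoint_self_iff {A : H →ₗ.[𝕜] E} {B : H →ₗ.[𝕜] F}
    (hAd : Dense (A.domain : Set H)) (hA : A.IsClosed) (hBd : Dense (B.domain : Set H))
    (hB : B.IsClosed) :
    FormLE (opComp A.adjoint A) (opComp B.adjoint B) ↔
      ∃ h : B.domain ≤ A.domain, ∀ g : B.domain, ‖A ⟨g, h g.2⟩‖ ≤ ‖B g‖ := by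
  have := completeSpace_graphSpace hA
  have := completeSpace_graphSpace hB
  have e1 : FormLE (opComp A.adjoint A) (opComp B.adjoint B) ↔
      ∀ x, ‖(graphFst B).adjoint x‖ ≤ ‖(graphFst A).adjoint x‖ := by
    refine forall_congr' fun x => ?_
    obtain ⟨h1, h1'⟩ := re_inner_inverse_idAdd hAd x
    obtain ⟨h2, h2'⟩ := re_inner_inverse_idAdd hBd x
    constructor
    · rintro ⟨_, _, h⟩
      rw [h1', h2'] at h
      exact (sq_le_sq₀ (norm_nonneg _) (norm_nonneg _)).1 h
    · intro h
      refine ⟨h1, h2, ?_⟩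
      rw [h1', h2']
      gcongr
  rw [e1]
  constructor
  · intro h
    have key : ∀ g : B.domain, ∃ hg : (g : H) ∈ A.domain, ‖A ⟨g, hg⟩‖ ≤ ‖B g‖ := fun g => by
      -- Douglas' lemma yields a point of the graph of `A` over the same `g`, of no larger graph
      -- norm; cancelling `‖g‖²` leaves the claim.
      obtain ⟨p, hp, hn⟩ := exists_apply_eq_of_norm_adjoint_le h (graphMk B g)
      obtain ⟨y, rfl⟩ := graphSpace.exists_rep p
      rw [graphFst_graphMk, graphFst_graphMk] at hp
      have hg : (g : H) ∈ A.domain := hp ▸ y.2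
      have hy : y = ⟨g, hg⟩ := Subtype.ext hp
      refine ⟨hg, ?_⟩
      rw [← sq_le_sq₀ (norm_nonneg _) (norm_nonneg _), norm_graphMk_sq, norm_graphMk_sq, hy] at hn
      exact (sq_le_sq₀ (norm_nonneg _) (norm_nonneg _)).1 (by linarith)
    exact ⟨fun g hg => (key ⟨g, hg⟩).1, fun g => (key g).2⟩
  · rintro ⟨h, hn⟩ x
    obtain ⟨g, hg⟩ := graphSpace.exists_rep ((graphFst B).adjoint x)
    let p := graphMk A ⟨g, h g.2⟩
    have hp : ‖p‖ ≤ ‖(graphFst B).adjoint x‖ := by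
      rw [← hg, ← sq_le_sq₀ (norm_nonneg _) (norm_nonneg _), norm_graphMk_sq, norm_graphMk_sq]
      have := hn g
      gcongr
    -- Both sides equal `re ⟪g, x⟫`, since the two graph points lie over the same `g`.
    have h1 : ‖(graphFst B).adjoint x‖ ^ 2 = RCLike.re (inner 𝕜 p ((graphFst A).adjoint x)) := by
      rw [← inner_self_eq_norm_sq (𝕜 := 𝕜), ContinuousLinearMap.adjoint_inner_right,
        ContinuousLinearMap.adjoint_inner_right, ← hg, graphFst_graphMk, graphFst_graphMk]
    have h2 := (RCLike.re_le_norm (inner 𝕜 p ((graphFst A).adjoint x))).trans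
      (norm_inner_le_norm _ _)
    rw [← h1] at h2
    have h3 := mul_le_mul_of_nonneg_right hp (norm_nonneg ((graphFst A).adjoint x))
    by_contra! hlt
    nlinarith [norm_nonneg ((graphFst A).adjoint x)]

end Resolvent

/-! ### Square roots of unbounded operators -/

section Sqrt

variable {𝕜 : Type*} [RCLike 𝕜]
variable {H : Type*} [NormedAddCommGroup H] [InnerProductSpace 𝕜 H] [CompleteSpace H]

/-- Weak solutions of `S y = w` are strong ones, because `S† = S`. -/
theorem exists_apply_eq_of_isSelfAdjoint {S : H →ₗ.[𝕜] H} (hS : IsSelfAdjoint S) {y w : H}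
    (h : ∀ x : S.domain, inner 𝕜 w (x : H) = inner 𝕜 y (S x)) :
    ∃ hy : y ∈ S.domain, S ⟨y, hy⟩ = w := by
  have h1 := LinearPMap.mem_adjoint_domain_of_exists (T := S) y ⟨w, h⟩
  have h2 := LinearPMap.adjoint_apply_eq hS.dense_domain ⟨y, h1⟩ h
  have h3 : (y, w) ∈ S.adjoint.graph := S.adjoint.mem_graph_iff.2 ⟨⟨y, h1⟩, rfl, h2⟩
  rw [LinearPMap.isSelfAdjoint_def.1 hS] at h3
  exact ⟨LinearPMap.mem_domain_of_mem_graph h3, ((S.image_iff _).2 h3).symm⟩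

/-- The everywhere defined bounded inverse of `I + S`. -/
theorem exists_resolvent {S : H →ₗ.[𝕜] H} (hp : IsPositive S) (hS : IsSelfAdjoint S) :
    ∃ B : H →L[𝕜] H, ∀ x, ∃ h : B x ∈ S.domain, S ⟨B x, h⟩ = x - B x := by
  have := completeSpace_graphSpace hS.isClosed
  let φ : graphSpace S →L[𝕜] H :=
    (WithLp.fstL 2 𝕜 H H + WithLp.sndL 2 𝕜 H H) ∘L (graphSpace S).subtypeL
  have hφ : ∀ u : S.domain, φ (graphMk S u) = u + S u := fun u => rfl
  -- Positivity makes the cross term in `‖u + S u‖²` nonnegative, so `φ` is bounded below and has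
  -- closed range. A vector `z` orthogonal to the range would satisfy `S z = -z`, hence vanish.
  have hanti : AntilipschitzWith 1 φ := by
    refine ContinuousLinearMap.antilipschitz_of_bound φ fun p => ?_
    obtain ⟨u, rfl⟩ := graphSpace.exists_rep p
    rw [NNReal.coe_one, one_mul, hφ, ← sq_le_sq₀ (norm_nonneg _) (norm_nonneg _), norm_graphMk_sq,
      norm_add_sq (𝕜 := 𝕜)]
    have h1 := hp.nonneg u
    rw [hp.symmetric] at h1
    linarith
  have hrange : LinearMap.range φ.toLinearMap = ⊤ := by
    have hc : _root_.IsClosed (LinearMap.range φ.toLinearMap : Set H) := by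
      rw [LinearMap.coe_range]
      exact hanti.isClosed_range φ.uniformContinuous
    have := hc.completeSpace_coe
    rw [← Submodule.orthogonal_eq_bot_iff, Submodule.eq_bot_iff]
    intro z hz
    have hz' : ∀ u : S.domain, inner 𝕜 (-z) (u : H) = inner 𝕜 z (S u) := fun u => by
      have h1 := (Submodule.mem_orthogonal' _ z).1 hz _ ⟨graphMk S u, rfl⟩
      have h2 : inner 𝕜 z ((u : H) + S u) = 0 := h1
      rw [inner_add_right] at h2
      rw [inner_neg_left]
      exact neg_eq_of_add_eq_zero_right h2
    obtain ⟨hzd, hSz⟩ := exists_apply_eq_of_isSelfAdjoint hS hz'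
    have h1 := hp.nonneg ⟨z, hzd⟩
    rw [hSz, inner_neg_left, map_neg, inner_self_eq_norm_sq] at h1
    have : ‖z‖ = 0 := by nlinarith [norm_nonneg z]
    exact norm_eq_zero.1 this
  let e := ContinuousLinearEquiv.ofBijective φ (LinearMap.ker_eq_bot.2 hanti.injective) hrange
  refine ⟨graphFst S ∘L e.symm.toContinuousLinearMap, fun x => ?_⟩
  obtain ⟨u, hu⟩ := graphSpace.exists_rep (e.symm x)
  have hB : (graphFst S ∘L e.symm.toContinuousLinearMap) x = u := by
    change graphFst S (e.symm x) = u
    rw [← hu, graphFst_graphMk]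
  have hx : (u : H) + S u = x := by
    rw [← hφ, hu]
    exact e.apply_symm_apply x
  rw [hB]
  exact ⟨u.2, by rw [← hx]; abel⟩

/-- Two positive bounded operators `P`, `Q` with `P² + Q² = 1`, of which `P` is injective and has a
positive square root commuting with `Q`, give rise to a positive self-adjoint operator `P x ↦ Q x`,
whose square is the operator `P² x ↦ Q² x`. -/
theorem exists_isPositiveSqrt_of_bounded {S : H →ₗ.[𝕜] H} {P Q L : H →L[𝕜] H} (hP : P.IsPositive)
    (hQ : Q.IsPositive) (hL : L.IsPositive) (hLP : L * L = P) (hLQ : Commute L Q)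
    (hPQ : P * P + Q * Q = 1) (hinj : ∀ x, P x = 0 → x = 0)
    (hSg : ∀ y z, (y, z) ∈ S.graph ↔ ∃ x, P (P x) = y ∧ Q (Q x) = z) :
    ∃ R : H →ₗ.[𝕜] H, IsPositiveSqrt R S := by
  have comm : ∀ x, P (Q x) = Q (P x) := fun x => by
    have : Commute P Q := hLP ▸ hLQ.mul_left hLQ
    exact DFunLike.congr_fun this.eq x
  have sum : ∀ x, P (P x) + Q (Q x) = x := fun x => DFunLike.congr_fun hPQ x
  let G : Submodule 𝕜 (H × H) := LinearMap.range (P.toLinearMap.prod Q.toLinearMap)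
  have hG : G.toLinearPMap.graph = G := by
    refine Submodule.toLinearPMap_graph_eq _ ?_
    rintro _ ⟨x, rfl⟩ h0
    have : P x = 0 := h0
    simp [hinj x this]
  let R := G.toLinearPMap
  have hR : ∀ y z, (y, z) ∈ R.graph ↔ ∃ x, P x = y ∧ Q x = z := fun y z => by
    rw [show R.graph = G from hG]
    simp [G, LinearMap.mem_range]
  have hRrep : ∀ u : R.domain, ∃ x, P x = u ∧ Q x = R u := fun u => (hR _ _).1 (R.mem_graph u)
  have hPd : ∀ x, ∃ h : P x ∈ R.domain, R ⟨P x, h⟩ = Q x := fun x => by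
    have h := (hR (P x) (Q x)).2 ⟨x, rfl, rfl⟩
    obtain ⟨u, hu, hv⟩ := R.mem_graph_iff.1 h
    obtain ⟨u, hu'⟩ := u
    simp only at hu hv
    subst hu
    exact ⟨hu', hv⟩
  have hdense : Dense (R.domain : Set H) := by
    have : R.domain.topologicalClosure = ⊤ := by
      rw [Submodule.topologicalClosure_eq_top_iff, Submodule.eq_bot_iff]
      intro z hz
      refine hinj z (ext_inner_right 𝕜 fun x => ?_)
      rw [hP.inner_left_eq_inner_right, inner_zero_left]
      exact (Submodule.mem_orthogonal' _ z).1 hz _ (hPd x).1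
    exact Submodule.dense_iff_topologicalClosure_eq_top.2 this
  have hsymm : ∀ f g : R.domain, inner 𝕜 (R f) (g : H) = inner 𝕜 (f : H) (R g) := fun f g => by
    obtain ⟨x, hx, hx'⟩ := hRrep f
    obtain ⟨y, hy, hy'⟩ := hRrep g
    rw [← hx, ← hx', ← hy, ← hy', hP.inner_left_eq_inner_right, comm, hQ.inner_left_eq_inner_right]
  refine ⟨R, ⟨hsymm, fun f => ?_⟩, ?_, ?_⟩
  · obtain ⟨x, hx, hx'⟩ := hRrep f
    -- The square root `L` of `P` turns `⟪Q x, P x⟫` into `⟪Q L x, L x⟫ ≥ 0`.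
    have h1 : P x = L (L x) := by rw [← hLP]; rfl
    have h2 : L (Q x) = Q (L x) := DFunLike.congr_fun hLQ.eq x
    rw [← hx, ← hx', h1, ← hL.inner_left_eq_inner_right, h2]
    exact hQ.re_inner_nonneg_left _
  · rw [LinearPMap.isSelfAdjoint_def]
    symm
    refine LinearPMap.eq_of_le_of_domain_eq
      (LinearPMap.IsFormalAdjoint.le_adjoint hdense hsymm) (le_antisymm ?_ ?_)
    · exact (LinearPMap.IsFormalAdjoint.le_adjoint hdense hsymm).1
    · intro y hy
      set z := R.adjoint ⟨y, hy⟩ with hz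
      have h1 : P z = Q y := by
        refine ext_inner_right 𝕜 fun x => ?_
        obtain ⟨hx, hx'⟩ := hPd x
        have := LinearPMap.adjoint_isFormalAdjoint hdense ⟨y, hy⟩ ⟨P x, hx⟩
        rw [hx', ← hz] at this
        rw [hP.inner_left_eq_inner_right, hQ.inner_left_eq_inner_right]
        exact this
      -- `P² + Q² = 1` together with `P z = Q y` exhibits `y` in the range of `P`, which is
      -- contained in `dom R`.
      have h2 : P (P y + Q z) = y := by
        rw [map_add, comm, h1, sum]
      rw [← h2]
      exact (hPd _).1
  · refine LinearPMap.eq_of_eq_graph (Submodule.ext fun ⟨y, z⟩ => ?_)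
    rw [hSg]
    constructor
    · intro h
      obtain ⟨⟨u, hu⟩, hu1, hu2⟩ := LinearPMap.mem_graph_iff _ |>.1 h
      obtain ⟨hud, hRu⟩ := mem_opComp_domain.1 hu
      rw [opComp_apply hud hRu] at hu2
      simp only at hu1 hu2
      obtain ⟨x, hx, hx'⟩ := hRrep ⟨u, hud⟩
      obtain ⟨x', hy, hy'⟩ := hRrep ⟨_, hRu⟩
      simp only at hx hy
      rw [hu2] at hy'
      rw [hu1] at hx
      rw [← hx'] at hy
      refine ⟨y + z, ?_, ?_⟩
      · rw [← hy', ← hx, map_add, map_add, comm x', hy, comm (Q x), comm x, sum]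
      · rw [← hy', ← hx, map_add, map_add, ← comm x, ← hy, ← comm, ← comm, sum]
    · rintro ⟨x, rfl, rfl⟩
      obtain ⟨h1, h1'⟩ := hPd (P x)
      obtain ⟨h2, h2'⟩ := hPd (Q x)
      have h3 : R ⟨P (P x), h1⟩ = P (Q x) := by rw [h1', comm]
      have h4 : R ⟨P (P x), h1⟩ ∈ R.domain := by rw [h3]; exact h2
      refine (LinearPMap.mem_graph_iff _).2
        ⟨⟨P (P x), mem_opComp_domain.2 ⟨h1, h4⟩⟩, rfl, ?_⟩
      rw [opComp_apply h1 h4, ← h2']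
      congr 1
      exact Subtype.ext h3

/-- Every positive self-adjoint operator has a positive self-adjoint square root. -/
theorem exists_isPositiveSqrt {S : H →ₗ.[𝕜] H} (hp : IsPositive S) (hS : IsSelfAdjoint S) :
    ∃ R : H →ₗ.[𝕜] H, IsPositiveSqrt R S := by
  obtain ⟨B, hB⟩ := exists_resolvent hp hS
  choose hBd hBS using hB
  have hBu : ∀ u : S.domain, B (u + S u) = u := fun u => by
    refine (inverse_idAdd_apply hp.nonneg ⟨_, hBd _⟩ ?_ (mem_inverse_idAdd_domain u)).symm.trans
      (inverse_idAdd_apply hp.nonneg u rfl _)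
    rw [hBS]
    abel
  have hBsymm : ∀ x y, inner 𝕜 (B x) y = inner 𝕜 x (B y) := fun x y => by
    have h := hp.symmetric ⟨_, hBd x⟩ ⟨_, hBd y⟩
    rw [hBS, hBS, inner_sub_left, inner_sub_right] at h
    exact (sub_left_inj.1 h).symm
  have hBsa : IsSelfAdjoint B := (ContinuousLinearMap.isSelfAdjoint_iff_isSymmetric).2 hBsymm
  have hsq : ∀ x, ‖B x‖ ^ 2 + ‖x - B x‖ ^ 2 ≤ ‖x‖ ^ 2 := fun x => by
    have h1 := hp.nonneg ⟨_, hBd x⟩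
    rw [hp.symmetric, hBS] at h1
    have h2 := norm_add_sq (𝕜 := 𝕜) (B x) (x - B x)
    rw [add_sub_cancel] at h2
    simp only at h1
    linarith
  have hB1 : ‖B‖ ≤ 1 := B.opNorm_le_bound zero_le_one fun x => by
    rw [one_mul, ← sq_le_sq₀ (norm_nonneg _) (norm_nonneg _)]
    nlinarith [hsq x]
  have hB2 : ‖1 - B‖ ≤ 1 := (1 - B).opNorm_le_bound zero_le_one fun x => by
    rw [one_mul, ← sq_le_sq₀ (norm_nonneg _) (norm_nonneg _)]
    change ‖x - B x‖ ^ 2 ≤ _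
    nlinarith [hsq x]
  -- With `B = (I + S)⁻¹`, `S` is `B x ↦ (1 - B) x`, so `P = B^{1/2}` and `Q = (1 - B)^{1/2}` are
  -- the data for its root; `L = B^{1/4}` serves positivity.
  obtain ⟨P, hP, hPP, hP1, hPc⟩ := exists_bounded_sqrt hBsa hB2
  obtain ⟨Q, hQ, hQQ, -, hQc⟩ := exists_bounded_sqrt (A := 1 - B) ((IsSelfAdjoint.one _).sub hBsa)
    (by simpa using hB1)
  obtain ⟨L, hL, hLL, -, hLc⟩ := exists_bounded_sqrt hP.isSelfAdjoint hP1
  have hQB : Commute Q B := by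
    have h : Commute B (1 - B) := (Commute.one_right B).sub_right (Commute.refl B)
    exact (hQc B h).symm
  have hPP' : ∀ x, P (P x) = B x := fun x => DFunLike.congr_fun hPP x
  have hQQ' : ∀ x, Q (Q x) = x - B x := fun x => DFunLike.congr_fun hQQ x
  refine exists_isPositiveSqrt_of_bounded hP hQ hL hLL (hLc Q (hPc Q hQB)).symm
    (by rw [hPP, hQQ]; abel) (fun x hx => ?_) fun y z => ?_
  · have h1 : B x = 0 := by rw [← hPP', hx, map_zero]
    have h2 := hBS x
    have h3 : S ⟨B x, hBd x⟩ = 0 := by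
      rw [← S.map_zero]
      congr 1
      exact Subtype.ext h1
    rw [h3, h1, sub_zero] at h2
    exact h2.symm
  · simp only [hPP', hQQ']
    constructor
    · intro h
      obtain ⟨u, rfl, rfl⟩ := S.mem_graph_iff.1 h
      exact ⟨u + S u, hBu u, by rw [hBu]; abel⟩
    · rintro ⟨x, rfl, rfl⟩
      exact S.mem_graph_iff.2 ⟨⟨_, hBd x⟩, rfl, hBS x⟩

theorem isPositiveSqrt_sqrtOp {S : H →ₗ.[𝕜] H} (hp : IsPositive S) (hS : IsSelfAdjoint S) :
    IsPositiveSqrt (sqrtOp S) S := by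
  have h := exists_isPositiveSqrt hp hS
  rw [sqrtOp, dif_pos h]
  exact h.choose_spec

end Sqrt

/-! ### Density of `𝓓_*(T)` and the adjoint of the energy embedding -/

section Energy

variable {𝕜 : Type*} [RCLike 𝕜]
variable {H : Type u} [NormedAddCommGroup H] [InnerProductSpace 𝕜 H]
variable {T : H →ₗ.[𝕜] H}

theorem EnergyPre.norm_mk_sq (hT : IsPositive T) (h : T.domain) :
    ‖EnergyPre.mk hT h‖ ^ 2 = RCLike.re (inner 𝕜 (T h) (h : H)) := by
  rw [← inner_self_eq_norm_sq (𝕜 := 𝕜), EnergyPre.inner_mk]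

theorem norm_inner_apply_le (hT : IsPositive T) (h g : T.domain) :
    ‖inner 𝕜 (g : H) (T h)‖ ≤ ‖EnergyPre.mk hT g‖ * ‖EnergyPre.mk hT h‖ := by
  rw [← hT.symmetric, ← EnergyPre.inner_mk hT]
  exact norm_inner_le_norm _ _

/-- `𝓓_*(T)` consists of the vectors inducing functionals bounded in the energy norm. -/
theorem mem_DStar_iff (hT : IsPositive T) {g : H} :
    g ∈ DStar T ↔ ∃ C, 0 ≤ C ∧ ∀ h : T.domain, ‖inner 𝕜 g (T h)‖ ≤ C * ‖EnergyPre.mk hT h‖ := by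
  constructor
  · rintro ⟨M, hM⟩
    refine ⟨√M, Real.sqrt_nonneg _, fun h => ?_⟩
    -- The energy norm is only a seminorm here and may vanish at `T h`, so one rescales by a
    -- strictly larger `s` and lets it decrease.
    have key : ∀ s : ℝ, ‖EnergyPre.mk hT h‖ < s → ‖inner 𝕜 g (T h)‖ ≤ √M * s := fun s hs => by
      have hs0 : 0 < s := (norm_nonneg _).trans_lt hs
      have hn : ‖((s : 𝕜))⁻¹‖ = s⁻¹ := by
        rw [norm_inv, RCLike.norm_ofReal, abs_of_pos hs0]
      have h1 : EnergyPre.mk hT ((s : 𝕜)⁻¹ • h) = (s : 𝕜)⁻¹ • EnergyPre.mk hT h :=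
        (LinearMap.rangeRestrict T.toFun).map_smul _ h
      have h2 : ‖inner 𝕜 (T ((s : 𝕜)⁻¹ • h)) g‖ ≤ √M := by
        refine Real.le_sqrt_of_sq_le (hM ⟨(s : 𝕜)⁻¹ • h, ?_, rfl⟩)
        rw [← EnergyPre.norm_mk_sq hT, h1, norm_smul, hn]
        refine pow_le_one₀ (by positivity) ?_
        rw [inv_mul_le_one₀ hs0]
        exact hs.le
      rw [T.map_smul, norm_inner_symm, inner_smul_right, norm_mul, hn, inv_mul_le_iff₀ hs0] at h2
      linarith
    have hlim : Tendsto (fun s => √M * s) (𝓝[>] ‖EnergyPre.mk hT h‖)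
        (𝓝 (√M * ‖EnergyPre.mk hT h‖)) :=
      ((continuous_const.mul continuous_id).tendsto _).mono_left nhdsWithin_le_nhds
    exact ge_of_tendsto hlim (eventually_mem_nhdsWithin.mono key)
  · rintro ⟨C, hC, hb⟩
    refine ⟨C ^ 2, ?_⟩
    rintro _ ⟨h, hh, rfl⟩
    rw [← EnergyPre.norm_mk_sq hT] at hh
    rw [norm_inner_symm]
    have h1 := (sq_le_one_iff₀ (norm_nonneg _)).1 hh
    gcongr
    exact (hb h).trans (mul_le_of_le_one_right hC h1)

theorem domain_le_DStar (hT : IsPositive T) : T.domain ≤ DStar T := fun g hg =>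
  (mem_DStar_iff hT).2 ⟨_, norm_nonneg _, fun h => norm_inner_apply_le hT h ⟨g, hg⟩⟩

theorem dense_DStar_of_orthogonal [CompleteSpace H] (h : ∀ z ∈ (DStar T)ᗮ, z = 0) :
    Dense (DStar T : Set H) := by
  rw [Submodule.dense_iff_topologicalClosure_eq_top, Submodule.topologicalClosure_eq_top_iff,
    Submodule.eq_bot_iff]
  exact h

/-- The energy seminorms of `S` and `T` agree on `dom T`, so Cauchy–Schwarz for the form of `S` puts
the dense subspace `dom S` inside `𝓓_*(T)`. -/
theorem dense_DStar_of_hasPositiveExtension [CompleteSpace H] (hT : IsPositive T)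
    (h : HasPositiveExtension T) : Dense (DStar T : Set H) := by
  obtain ⟨S, hS, hSa, hle⟩ := h
  refine hSa.dense_domain.mono fun g hg => (mem_DStar_iff hT).2
    ⟨‖EnergyPre.mk hS ⟨g, hg⟩‖, norm_nonneg _, fun h => ?_⟩
  have h1 : S ⟨h, hle.1 h.2⟩ = T h := (hle.2 rfl).symm
  have h2 : ‖EnergyPre.mk hS ⟨h, hle.1 h.2⟩‖ = ‖EnergyPre.mk hT h‖ := by
    rw [← sq_eq_sq₀ (norm_nonneg _) (norm_nonneg _), EnergyPre.norm_mk_sq, EnergyPre.norm_mk_sq, h1]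
  rw [← h1, ← h2]
  exact norm_inner_apply_le hS _ ⟨g, hg⟩

/-- If `z = u + T u` is orthogonal to `𝓓_*(T)`, it is orthogonal to `u ∈ dom T ⊆ 𝓓_*(T)`, which
forces `u = 0`. -/
theorem dense_DStar_of_orthogonal_le_range [CompleteSpace H] (hT : IsPositive T)
    (h : (DStar T)ᗮ ≤ LinearMap.range (idAdd T).toFun) : Dense (DStar T : Set H) := by
  refine dense_DStar_of_orthogonal fun z hz => ?_
  obtain ⟨⟨u, hu⟩, huz⟩ := h hz
  have hu' := mem_idAdd_domain.1 hu
  have h1 : u + T ⟨u, hu'⟩ = z := huz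
  have h2 := (Submodule.mem_orthogonal' _ z).1 hz u (domain_le_DStar hT hu')
  rw [← h1, inner_add_left] at h2
  have h3 := congrArg RCLike.re h2
  rw [map_add, inner_self_eq_norm_sq, map_zero] at h3
  have h4 : 0 ≤ RCLike.re (inner 𝕜 (T ⟨u, hu'⟩) u) := hT.nonneg ⟨u, hu'⟩
  have h5 : ‖u‖ = 0 := by nlinarith [norm_nonneg u]
  have h6 : (⟨u, hu'⟩ : T.domain) = 0 := Subtype.ext (norm_eq_zero.1 h5)
  rw [← h1, h6, T.map_zero, norm_eq_zero.1 h5, add_zero]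

/-- `(ran T)^⊥ ⊆ 𝓓_*(T)`, so `𝓓_*(T)^⊥` automatically lies in the closure of `ran T`. -/
theorem dense_DStar_of_orthogonal_inf_closure [CompleteSpace H] (hT : IsPositive T)
    (h : (DStar T)ᗮ ⊓ (LinearMap.range T.toFun).topologicalClosure = ⊥) :
    Dense (DStar T : Set H) := by
  refine dense_DStar_of_orthogonal fun z hz => ?_
  rw [Submodule.eq_bot_iff] at h
  refine h z ⟨hz, ?_⟩
  rw [← Submodule.orthogonal_orthogonal_eq_closure]
  refine Submodule.orthogonal_le (fun g hg => ?_) hz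
  refine (mem_DStar_iff hT).2 ⟨0, le_rfl, fun k => ?_⟩
  rw [(Submodule.mem_orthogonal' _ g).1 hg (T k) ⟨k, rfl⟩]
  simp

/-- Any pair orthogonal to all `(T k, T k)` in `E_T ⊕ H` has second component in `𝓓_*(T)`. Hence for
`z ⊥ 𝓓_*(T)` the pair `(0, z)` is a limit of such `(T k, T k)`, and closability gives `z = 0`. -/
theorem dense_DStar_of_isPositivelyClosable [CompleteSpace H] (hT : IsPositive T)
    (h : IsPositivelyClosable T) : Dense (DStar T : Set H) := by
  refine dense_DStar_of_orthogonal fun z hz => ?_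
  let φ : T.domain →ₗ[𝕜] WithLp 2 (EnergySpace hT × H) :=
    (WithLp.linearEquiv 2 𝕜 (EnergySpace hT × H)).symm.toLinearMap ∘ₗ
      (((UniformSpace.Completion.toComplₗᵢ (𝕜 := 𝕜) (E := EnergyPre hT)).toLinearMap ∘ₗ
        LinearMap.rangeRestrict T.toFun).prod T.toFun)
  have hφ : ∀ k, φ k = WithLp.toLp 2 ((EnergyPre.mk hT k : EnergySpace hT), T k) := fun k => rfl
  have hmem : WithLp.toLp 2 ((0 : EnergySpace hT), z) ∈ (LinearMap.range φ)ᗮᗮ := by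
    rw [Submodule.mem_orthogonal]
    intro p hp
    have hpg : p.snd ∈ DStar T := (mem_DStar_iff hT).2 ⟨‖p.fst‖, norm_nonneg _, fun k => by
      have h1 := (Submodule.mem_orthogonal' _ p).1 hp _ ⟨k, rfl⟩
      rw [hφ, WithLp.prod_inner_apply] at h1
      have h2 : inner 𝕜 p.snd (T k) = -inner 𝕜 p.fst (EnergyPre.mk hT k : EnergySpace hT) :=
        eq_neg_of_add_eq_zero_right h1
      rw [h2, norm_neg, ← UniformSpace.Completion.norm_coe (EnergyPre.mk hT k)]
      exact norm_inner_le_norm _ _⟩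
    rw [WithLp.prod_inner_apply]
    simpa using (Submodule.mem_orthogonal _ z).1 hz _ hpg
  rw [Submodule.orthogonal_orthogonal_eq_closure] at hmem
  obtain ⟨q, hq, hlim⟩ := mem_closure_iff_seq_limit.1 hmem
  choose k hk using hq
  have hlim' := (WithLp.prod_continuous_ofLp 2 (EnergySpace hT) H).tendsto _ |>.comp hlim
  have h1 := (continuous_fst.tendsto _).comp hlim'
  have h2 := (continuous_snd.tendsto _).comp hlim'
  refine h k z ?_ (h2.congr fun n => ?_)
  · have h3 := (h1.norm).pow 2
    rw [norm_zero, zero_pow two_ne_zero] at h3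
    refine h3.congr fun n => ?_
    simp only [Function.comp_apply, ← hk, hφ]
    rw [UniformSpace.Completion.norm_coe, EnergyPre.norm_mk_sq]
  · simp only [Function.comp_apply, ← hk, hφ]

theorem dense_DStar_of_hasFactorization (hT : IsPositive T) (h : HasFactorization T) :
    Dense (DStar T : Set H) := by
  obtain ⟨E, _, _, _, V, hTV, hd, -, hV⟩ := h
  refine hd.mono fun g hg => (mem_DStar_iff hT).2 ⟨‖V ⟨g, hg⟩‖, norm_nonneg _, fun k => ?_⟩
  have h1 : ‖V ⟨k, hTV k.2⟩‖ = ‖EnergyPre.mk hT k‖ := by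
    rw [← sq_eq_sq₀ (norm_nonneg _) (norm_nonneg _), EnergyPre.norm_mk_sq, hT.symmetric,
      ← inner_self_eq_norm_sq (𝕜 := 𝕜), hV ⟨k, hTV k.2⟩ k]
  rw [← hV ⟨g, hg⟩ k, ← h1]
  exact norm_inner_le_norm _ _

theorem IsExtendable.dense_DStar [CompleteSpace H] (hT : IsPositive T) (h : IsExtendable T) :
    Dense (DStar T : Set H) := by
  cases h with
  | extension h => exact dense_DStar_of_hasPositiveExtension hT h
  | dense h => exact h
  | orthogonal_le_range h => exact dense_DStar_of_orthogonal_le_range hT h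
  | orthogonal_inf_closure h => exact dense_DStar_of_orthogonal_inf_closure hT h
  | positivelyClosable h => exact dense_DStar_of_isPositivelyClosable hT h
  | factorization h => exact dense_DStar_of_hasFactorization hT h

/-- Density of `𝓓_*(T)` makes `J` single-valued: if `T h` has energy norm zero, it is orthogonal to
`𝓓_*(T)`. -/
theorem mem_graph_energyEmbedding_iff (hT : IsPositive T) (hd : Dense (DStar T : Set H))
    {x : EnergySpace hT} {y : H} :
    (x, y) ∈ (energyEmbedding hT).graph ↔
      ∃ h : T.domain, (EnergyPre.mk hT h : EnergySpace hT) = x ∧ T h = y := by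
  have hG : (energyEmbedding hT).graph = LinearMap.range ((UniformSpace.Completion.toComplₗᵢ
      (𝕜 := 𝕜) (E := EnergyPre hT)).toLinearMap.prod (EnergyPre.val hT)) := by
    refine Submodule.toLinearPMap_graph_eq _ ?_
    rintro _ ⟨p, rfl⟩ h0
    obtain ⟨h, rfl⟩ := EnergyPre.exists_rep hT p
    have h1 : (EnergyPre.mk hT h : EnergySpace hT) = 0 := h0
    have h2 : ‖EnergyPre.mk hT h‖ = 0 := by
      rw [← UniformSpace.Completion.norm_coe, h1, norm_zero]
    change T h = 0
    refine hd.eq_zero_of_inner_right 𝕜 fun g hg => ?_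
    obtain ⟨C, -, hC⟩ := (mem_DStar_iff hT).1 hg
    have := hC h
    rw [h2, mul_zero] at this
    exact norm_le_zero_iff.1 this
  rw [hG]
  constructor
  · rintro ⟨p, hp⟩
    obtain ⟨h, rfl⟩ := EnergyPre.exists_rep hT p
    exact ⟨h, (Prod.ext_iff.1 hp).1, (Prod.ext_iff.1 hp).2⟩
  · rintro ⟨h, rfl, rfl⟩
    exact ⟨EnergyPre.mk hT h, rfl⟩

theorem energyEmbedding_coe_mk (hT : IsPositive T) (hd : Dense (DStar T : Set H)) (h : T.domain) :
    ∃ hm : (EnergyPre.mk hT h : EnergySpace hT) ∈ (energyEmbedding hT).domain,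
      energyEmbedding hT ⟨EnergyPre.mk hT h, hm⟩ = T h := by
  have h1 := (mem_graph_energyEmbedding_iff hT hd).2 ⟨h, rfl, rfl⟩
  exact ⟨LinearPMap.mem_domain_of_mem_graph h1, ((LinearPMap.image_iff _).2 h1).symm⟩

theorem exists_energyEmbedding_rep (hT : IsPositive T) (hd : Dense (DStar T : Set H))
    (x : (energyEmbedding hT).domain) :
    ∃ h : T.domain, (EnergyPre.mk hT h : EnergySpace hT) = x ∧ T h = energyEmbedding hT x :=
  (mem_graph_energyEmbedding_iff hT hd).1 ((energyEmbedding hT).mem_graph x)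

theorem dense_energyEmbedding_domain (hT : IsPositive T) (hd : Dense (DStar T : Set H)) :
    Dense ((energyEmbedding hT).domain : Set (EnergySpace hT)) := by
  refine UniformSpace.Completion.denseRange_coe.mono ?_
  rintro _ ⟨p, rfl⟩
  obtain ⟨h, rfl⟩ := EnergyPre.exists_rep hT p
  exact (energyEmbedding_coe_mk hT hd h).1

theorem inner_adjoint_energyEmbedding (hT : IsPositive T) (hd : Dense (DStar T : Set H))
    (g : (energyEmbedding hT).adjoint.domain) (h : T.domain) :
    inner 𝕜 ((energyEmbedding hT).adjoint g) (EnergyPre.mk hT h : EnergySpace hT)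
      = inner 𝕜 (g : H) (T h) := by
  obtain ⟨hm, he⟩ := energyEmbedding_coe_mk hT hd h
  rw [← he]
  exact LinearPMap.adjoint_isFormalAdjoint (dense_energyEmbedding_domain hT hd) g ⟨_, hm⟩

theorem DStar_le_adjoint_domain (hT : IsPositive T) (hd : Dense (DStar T : Set H)) :
    DStar T ≤ (energyEmbedding hT).adjoint.domain := by
  intro g hg
  obtain ⟨C, -, hC⟩ := (mem_DStar_iff hT).1 hg
  rw [LinearPMap.mem_adjoint_domain_iff]
  refine AddMonoidHomClass.continuous_of_bound _ C fun x => ?_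
  obtain ⟨h, hx, hy⟩ := exists_energyEmbedding_rep hT hd x
  have h1 := hC h
  rw [hy, ← UniformSpace.Completion.norm_coe (EnergyPre.mk hT h), hx] at h1
  exact h1

theorem adjoint_energyEmbedding_apply (hT : IsPositive T) (hd : Dense (DStar T : Set H))
    (f : T.domain) :
    ∃ hf : (f : H) ∈ (energyEmbedding hT).adjoint.domain,
      (energyEmbedding hT).adjoint ⟨f, hf⟩ = (EnergyPre.mk hT f : EnergySpace hT) := by
  refine ⟨DStar_le_adjoint_domain hT hd (domain_le_DStar hT f.2),
    LinearPMap.adjoint_apply_eq (dense_energyEmbedding_domain hT hd) _ fun x => ?_⟩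
  obtain ⟨h, hx, hy⟩ := exists_energyEmbedding_rep hT hd x
  rw [← hx, ← hy, UniformSpace.Completion.inner_coe, EnergyPre.inner_mk, hT.symmetric]

/-- The norm of `J* g` can be tested on the dense subspace `ran T`, where `J* g` acts as `T k ↦ ⟪g,
T k⟫`. -/
theorem norm_adjoint_energyEmbedding_le (hT : IsPositive T) (hd : Dense (DStar T : Set H))
    {g : H} {c : ℝ} (hc : 0 ≤ c) (h : ∀ k : T.domain, ‖inner 𝕜 g (T k)‖ ≤ c * ‖EnergyPre.mk hT k‖) :
    ∃ hg : g ∈ (energyEmbedding hT).adjoint.domain, ‖(energyEmbedding hT).adjoint ⟨g, hg⟩‖ ≤ c := by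
  refine ⟨DStar_le_adjoint_domain hT hd ((mem_DStar_iff hT).2 ⟨c, hc, h⟩), ?_⟩
  set v := (energyEmbedding hT).adjoint ⟨g, _⟩ with hv
  have key : ∀ x : EnergySpace hT, ‖inner 𝕜 v x‖ ≤ c * ‖x‖ := fun x => by
    induction x using UniformSpace.Completion.induction_on with
    | hp => exact isClosed_le (by fun_prop) (by fun_prop)
    | ih p =>
      obtain ⟨k, rfl⟩ := EnergyPre.exists_rep hT p
      rw [hv, inner_adjoint_energyEmbedding hT hd, UniformSpace.Completion.norm_coe]
      exact h k
  have h1 := key v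
  rw [inner_self_eq_norm_sq_to_K, norm_pow, RCLike.norm_ofReal, abs_norm, sq] at h1
  by_contra! hlt
  nlinarith [norm_nonneg v]

end Energy

/-! ### Comparing `S` with the Krein–von Neumann extension -/

section Comparison

variable {𝕜 : Type*} [RCLike 𝕜]

/-- If `‖A x‖ ≤ ‖B x‖` for all `x`, with equality at `f`, then `A` and `B` have the same inner
products with their values at `f`. -/
theorem inner_apply_eq_of_norm_le {X E F : Type*} [AddCommGroup X] [Module 𝕜 X]
    [NormedAddCommGroup E] [InnerProductSpace 𝕜 E] [NormedAddCommGroup F] [InnerProductSpace 𝕜 F]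
    {A : X →ₗ[𝕜] E} {B : X →ₗ[𝕜] F} (h : ∀ x, ‖A x‖ ≤ ‖B x‖) {f : X} (hf : ‖B f‖ ≤ ‖A f‖) (g : X) :
    inner 𝕜 (A f) (A g) = inner 𝕜 (B f) (B g) := by
  set d : 𝕜 := inner 𝕜 (B f) (B g) - inner 𝕜 (A f) (A g) with hd
  have hfe : ‖B f‖ = ‖A f‖ := le_antisymm hf (h f)
  -- Test the inequality at `g - t d f`: the terms quadratic in `t` cancel since the norms agree at
  -- `f`. An affine function of `t` that is nonnegative on all of `ℝ` has slope zero, so `d = 0`.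
  have key : ∀ t : ℝ, 0 ≤ ‖B g‖ ^ 2 - ‖A g‖ ^ 2 - 2 * t * ‖d‖ ^ 2 := fun t => by
    have h1 := pow_le_pow_left₀ (norm_nonneg _) (h (g - ((t : 𝕜) * d) • f)) 2
    rw [map_sub, map_sub, map_smul, map_smul, norm_sub_sq (𝕜 := 𝕜), norm_sub_sq (𝕜 := 𝕜),
      norm_smul, norm_smul, hfe, inner_smul_right, inner_smul_right] at h1
    have h2 : RCLike.re ((t : 𝕜) * d * inner 𝕜 (B g) (B f))
        - RCLike.re ((t : 𝕜) * d * inner 𝕜 (A g) (A f)) = t * ‖d‖ ^ 2 := by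
      rw [← map_sub, ← mul_sub, ← inner_conj_symm (B g), ← inner_conj_symm (A g), ← map_sub, ← hd,
        mul_assoc, RCLike.mul_conj, RCLike.re_ofReal_mul, ← RCLike.ofReal_pow, RCLike.ofReal_re]
    linarith
  by_contra hne
  have hd0 : 0 < ‖d‖ ^ 2 := by
    have : d ≠ 0 := fun h0 => hne (sub_eq_zero.1 h0).symm
    positivity
  -- This `t` makes the affine function equal to `-1`.
  have h1 := key ((‖B g‖ ^ 2 - ‖A g‖ ^ 2 + 1) / (2 * ‖d‖ ^ 2))
  have h2 : 2 * ((‖B g‖ ^ 2 - ‖A g‖ ^ 2 + 1) / (2 * ‖d‖ ^ 2)) * ‖d‖ ^ 2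
      = ‖B g‖ ^ 2 - ‖A g‖ ^ 2 + 1 := by
    generalize ‖d‖ ^ 2 = D at hd0
    field_simp
  rw [h2] at h1
  linarith

variable {H : Type u} [NormedAddCommGroup H] [InnerProductSpace 𝕜 H] [CompleteSpace H]
variable {T S R : H →ₗ.[𝕜] H}

theorem IsPositiveSqrt.adjoint_self (h : IsPositiveSqrt R S) : opComp R.adjoint R = S := by
  rw [LinearPMap.isSelfAdjoint_def.1 h.2.1, h.2.2]

theorem IsPositiveSqrt.exists_apply (h : IsPositiveSqrt R S) (f : S.domain) :
    ∃ (hf : (f : H) ∈ R.domain), ∀ g : R.domain,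
      inner 𝕜 (R ⟨f, hf⟩) (R g) = inner 𝕜 (S f) (g : H) := by
  obtain ⟨hp, -, rfl⟩ := h
  obtain ⟨f, hfd⟩ := f
  obtain ⟨hf, hRf⟩ := mem_opComp_domain.1 hfd
  refine ⟨hf, fun g => ?_⟩
  rw [opComp_apply hf hRf, hp.symmetric ⟨_, hRf⟩ g]

/-- The identity says that `R f` lies in `dom R† = dom R` with `R R f = T f`. -/
theorem IsPositiveSqrt.le_of_inner_eq (h : IsPositiveSqrt R S) (hdom : T.domain ≤ R.domain)
    (hT : ∀ (f : T.domain) (g : R.domain),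
      inner 𝕜 (R ⟨f, hdom f.2⟩) (R g) = inner 𝕜 (T f) (g : H)) : T ≤ S := by
  obtain ⟨-, hsa, rfl⟩ := h
  have key : ∀ f : T.domain, ∃ hf : R ⟨f, hdom f.2⟩ ∈ R.domain, R ⟨_, hf⟩ = T f := fun f =>
    exists_apply_eq_of_isSelfAdjoint hsa fun g => (hT f g).symm
  refine ⟨fun f hf => mem_opComp_domain.2 ⟨hdom hf, (key ⟨f, hf⟩).1⟩, ?_⟩
  rintro ⟨f, hf⟩ ⟨_, hf'⟩ rfl
  obtain ⟨h1, h2⟩ := key ⟨f, hf⟩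
  rw [opComp_apply (hdom hf) h1, h2]

theorem IsPositiveSqrt.norm_apply_sq (h : IsPositiveSqrt R S) (f : S.domain)
    (hf : (f : H) ∈ R.domain) : ‖R ⟨f, hf⟩‖ ^ 2 = RCLike.re (inner 𝕜 (S f) (f : H)) := by
  obtain ⟨hf, h1⟩ := h.exists_apply f
  rw [← inner_self_eq_norm_sq (𝕜 := 𝕜), h1]

/-- Both operators have the shape `A† A` with `A` closed and densely defined: `A = J*` on the left
and `A = R` on the right. -/
theorem formLE_kreinVonNeumann_iff (hT : IsPositive T) (hd : Dense (DStar T : Set H))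
    (h : IsPositiveSqrt R S) :
    FormLE (kreinVonNeumann hT) S ↔ ∃ hdom : R.domain ≤ (energyEmbedding hT).adjoint.domain,
      ∀ g : R.domain, ‖(energyEmbedding hT).adjoint ⟨g, hdom g.2⟩‖ ≤ ‖R g‖ := by
  rw [← h.adjoint_self]
  exact formLE_adjoint_self_iff (hd.mono (DStar_le_adjoint_domain hT hd))
    (LinearPMap.adjoint_isClosed (dense_energyEmbedding_domain hT hd)) h.2.1.dense_domain
    h.2.1.isClosed

/-- A positive self-adjoint operator with square root `R` extends `T` if and only if it lies above
the Krein-von Neumann extension and its form is dominated by that of `T` on `dom T`. -/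
theorem le_iff_formLE_kreinVonNeumann (hT : IsPositive T) (hd : Dense (DStar T : Set H))
    (h : IsPositiveSqrt R S) :
    T ≤ S ↔ FormLE (kreinVonNeumann hT) S ∧ ∃ hdom : T.domain ≤ R.domain,
      ∀ f : T.domain, ‖R ⟨f, hdom f.2⟩‖ ^ 2 ≤ RCLike.re (inner 𝕜 (T f) (f : H)) := by
  rw [formLE_kreinVonNeumann_iff hT hd h]
  constructor
  · intro hle
    have hST : ∀ f : T.domain, S ⟨f, hle.1 f.2⟩ = T f := fun f => (hle.2 rfl).symm
    have hdom : T.domain ≤ R.domain := fun f hf => (h.exists_apply ⟨f, hle.1 hf⟩).1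
    have hn : ∀ f : T.domain, ‖R ⟨f, hdom f.2⟩‖ ^ 2 = RCLike.re (inner 𝕜 (T f) (f : H)) :=
      fun f => by rw [h.norm_apply_sq ⟨f, hle.1 f.2⟩, hST]
    have key : ∀ g : R.domain, ∃ hg : (g : H) ∈ (energyEmbedding hT).adjoint.domain,
        ‖(energyEmbedding hT).adjoint ⟨g, hg⟩‖ ≤ ‖R g‖ := fun g => by
      refine norm_adjoint_energyEmbedding_le hT hd (norm_nonneg _) fun k => ?_
      obtain ⟨h1, h2⟩ := h.exists_apply ⟨k, hle.1 k.2⟩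
      have h3 : ‖R ⟨k, h1⟩‖ = ‖EnergyPre.mk hT k‖ := by
        rw [← sq_eq_sq₀ (norm_nonneg _) (norm_nonneg _), EnergyPre.norm_mk_sq, ← hn]
      rw [norm_inner_symm, ← hST, ← h2 g, ← h3, mul_comm]
      exact norm_inner_le_norm _ _
    exact ⟨⟨fun g hg => (key ⟨g, hg⟩).1, fun g => (key g).2⟩, hdom, fun f => (hn f).le⟩
  · rintro ⟨⟨hRJ, hle⟩, hdom, hn⟩
    refine h.le_of_inner_eq hdom fun f g => ?_
    obtain ⟨h1, h2⟩ := adjoint_energyEmbedding_apply hT hd f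
    -- At `f ∈ dom T` the two bounds meet, since `‖J* f‖² = ⟪T f, f⟫`; equality of norms upgrades to
    -- equality of inner products with every `g ∈ dom R`.
    have h3 := inner_apply_eq_of_norm_le
      (A := (energyEmbedding hT).adjoint.toFun ∘ₗ Submodule.inclusion hRJ) (B := R.toFun) hle
      (f := ⟨f, hdom f.2⟩) (by
        change ‖R ⟨f, hdom f.2⟩‖ ≤ ‖(energyEmbedding hT).adjoint ⟨f, h1⟩‖
        rw [h2, UniformSpace.Completion.norm_coe, ← sq_le_sq₀ (norm_nonneg _) (norm_nonneg _),
          EnergyPre.norm_mk_sq]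
        exact hn f) g
    refine Eq.trans h3.symm ?_
    change inner 𝕜 ((energyEmbedding hT).adjoint ⟨f, h1⟩)
      ((energyEmbedding hT).adjoint ⟨g, hRJ g.2⟩) = _
    rw [h2, ← inner_conj_symm, inner_adjoint_energyEmbedding hT hd, inner_conj_symm]

end Comparison

end KreinExtension

theorem mainTheorem5 {𝕜 : Type*} [RCLike 𝕜] {H : Type*} [NormedAddCommGroup H]
    [InnerProductSpace 𝕜 H] [CompleteSpace H] (T : H →ₗ.[𝕜] H)
    (hT : KreinExtension.IsPositive T) (hExt : KreinExtension.IsExtendable T) :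
    (∀ S : H →ₗ.[𝕜] H, KreinExtension.IsPositive S → IsSelfAdjoint S →
      (T ≤ S ↔
        KreinExtension.FormLE (KreinExtension.kreinVonNeumann hT) S ∧
        ∃ hdom : T.domain ≤ (KreinExtension.sqrtOp S).domain,
          ∀ f : T.domain,
            ‖KreinExtension.sqrtOp S ⟨f, hdom f.2⟩‖ ^ 2 ≤
              RCLike.re (inner 𝕜 (T f) (f : H)))) ∧
    (∀ R S : H →ₗ.[𝕜] H, KreinExtension.IsPositive R → IsSelfAdjoint R →
      KreinExtension.IsPositive S → IsSelfAdjoint S →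
      T ≤ R → KreinExtension.FormLE (KreinExtension.kreinVonNeumann hT) S →
      KreinExtension.FormLE S R → T ≤ S) := by
  have hd := hExt.dense_DStar hT
  refine ⟨fun S hS hSa => KreinExtension.le_iff_formLE_kreinVonNeumann hT hd
    (KreinExtension.isPositiveSqrt_sqrtOp hS hSa), fun R S hR hRa hS hSa hTR hNS hSR => ?_⟩
  have hr := KreinExtension.isPositiveSqrt_sqrtOp hR hRa
  have hs := KreinExtension.isPositiveSqrt_sqrtOp hS hSa
  rw [← hs.adjoint_self, ← hr.adjoint_self, KreinExtension.formLE_adjoint_self_iff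
    hs.2.1.dense_domain hs.2.1.isClosed hr.2.1.dense_domain hr.2.1.isClosed] at hSR
  obtain ⟨hdom, hle⟩ := hSR
  obtain ⟨-, hdom', hn⟩ := (KreinExtension.le_iff_formLE_kreinVonNeumann hT hd hr).1 hTR
  refine (KreinExtension.le_iff_formLE_kreinVonNeumann hT hd hs).2
    -- The bound chains as `‖S^{1/2} f‖² ≤ ‖R^{1/2} f‖² ≤ ⟪T f, f⟫`.
    ⟨hNS, hdom'.trans hdom, fun f => le_trans ?_ (hn f)⟩
  exact pow_le_pow_left₀ (norm_nonneg _) (hle ⟨f, hdom' f.2⟩) 2
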